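/- Let $r\ge 1$ and $d\ge 2$ be integers. Call an $r$-tuple $\gamma=(\gamma_1,\ldots,\gamma_r)\in \mathrm{SO}(d)^r$ of real special orthogonal $d\times d$ matrices *generic* if every polynomial $p$ with rational coefficients in $d^2r$ variables that vanishes on the $d^2r$ matrix entries of $\gamma_1,\ldots,\gamma_r$ also vanishes on the matrix entries of $\beta$ for every $\beta\in\mathrm{SO}(d)^r$. Let $\mathcal N$ be the set of those $r$-tuples in $\mathrm{SO}(d)^r$ that are not generic. Then the following statements hold. (i) The set $\mathcal N$ has measure $0$ with respect to the Haar measure on the group $\mathrm{SO}(d)^r$. (ii) The set $\mathcal N$ is a meager subset of $\mathrm{SO}(d)^r$ with respect to the topology induced by the Euclidean topology on $\mathbb R^{d^2r}\supseteq \mathrm{SO}(d)^r$. -/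

import Mathlib

open MeasureTheory

/-- The group `SO(d)` of real orthogonal `d × d` matrices of determinant one. It carries the subspace
topology from `Matrix (Fin d) (Fin d) ℝ`, that is, from the Euclidean topology on the entries. -/
abbrev SO (d : ℕ) : Type := Matrix.specialOrthogonalGroup (Fin d) ℝ

namespace SO

theorem mem_iff {d : ℕ} (A : Matrix (Fin d) (Fin d) ℝ) :
    A ∈ Matrix.specialOrthogonalGroup (Fin d) ℝ ↔ A.transpose * A = 1 ∧ A.det = 1 := by
  rw [Matrix.mem_specialOrthogonalGroup_iff, Matrix.mem_orthogonalGroup_iff']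

theorem coe_inv {d : ℕ} (A : SO d) :
    ((A⁻¹ : SO d) : Matrix (Fin d) (Fin d) ℝ) = (A : Matrix (Fin d) (Fin d) ℝ).transpose := rfl

instance instIsTopologicalGroup (d : ℕ) : IsTopologicalGroup (SO d) where
  continuous_mul := by
    refine Continuous.subtype_mk ?_ _
    exact (continuous_subtype_val.comp continuous_fst).matrix_mul
      (continuous_subtype_val.comp continuous_snd)
  continuous_inv := by
    refine continuous_induced_rng.2 ?_
    exact continuous_subtype_val.matrix_transpose

instance instSecondCountableTopology (d : ℕ) : SecondCountableTopology (SO d) :=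
  haveI : SecondCountableTopology (Matrix (Fin d) (Fin d) ℝ) :=
    inferInstanceAs (SecondCountableTopology (Fin d → Fin d → ℝ))
  TopologicalSpace.Subtype.secondCountableTopology _

instance instCompactSpace (d : ℕ) : CompactSpace (SO d) := by
  refine isCompact_iff_compactSpace.1 ?_
  have hK : IsCompact (Set.pi Set.univ fun _ : Fin d => Set.pi Set.univ fun _ : Fin d =>
      Set.Icc (-1 : ℝ) 1) :=
    isCompact_univ_pi fun _ => isCompact_univ_pi fun _ => isCompact_Icc
  refine IsCompact.of_isClosed_subset (X := Matrix (Fin d) (Fin d) ℝ) hK ?_ ?_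
  · have h : ((Matrix.specialOrthogonalGroup (Fin d) ℝ : Submonoid _) :
        Set (Matrix (Fin d) (Fin d) ℝ)) = {A | A.transpose * A = 1} ∩ {A | A.det = 1} := by
      ext A; exact mem_iff A
    rw [h]
    exact (isClosed_eq (continuous_id.matrix_transpose.matrix_mul continuous_id)
      continuous_const).inter (isClosed_eq continuous_id.matrix_det continuous_const)
  · intro A hA i _ j _
    have h := congrFun (congrFun ((mem_iff A).1 hA).1 j) j
    rw [Matrix.mul_apply, Matrix.one_apply_eq] at h
    have h2 : A i j * A i j ≤ ∑ k, A.transpose j k * A k j :=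
      Finset.single_le_sum (f := fun k => A.transpose j k * A k j)
        (fun k _ => mul_self_nonneg (A k j)) (Finset.mem_univ i)
    rw [h] at h2
    constructor <;> nlinarith

/-- The Borel σ-algebra on `SO(d)`. -/
instance instMeasurableSpace (d : ℕ) : MeasurableSpace (SO d) := borel (SO d)

instance instBorelSpace (d : ℕ) : BorelSpace (SO d) := ⟨rfl⟩

/-- The product group `SO(d)^r`, with its product topology and product σ-algebra, is a compact
topological group with its Borel σ-algebra, so that it has a Haar measure. -/
theorem exists_isHaarMeasure (r d : ℕ) :
    ∃ ν : Measure (Fin r → SO d), ν.IsHaarMeasure ∧ IsProbabilityMeasure ν :=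
  ⟨Measure.haarMeasure ⊤, inferInstance, ⟨Measure.haarMeasure_self⟩⟩

/-- The point of `ℝ^(d²r)` formed by the matrix entries of an `r`-tuple in `SO(d)^r`. -/
def entries {r d : ℕ} (γ : Fin r → SO d) : Fin r × Fin d × Fin d → ℝ :=
  fun t => (γ t.1 : Matrix (Fin d) (Fin d) ℝ) t.2.1 t.2.2

/-- The topology of `SO(d)^r` is the one induced by the Euclidean topology of `ℝ^(d²r)`. -/
theorem isEmbedding_entries (r d : ℕ) :
    Topology.IsEmbedding fun γ : Fin r → SO d => WithLp.toLp 2 (entries γ) := by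
  have hc : Continuous (entries : (Fin r → SO d) → _) :=
    continuous_pi fun t =>
      (continuous_subtype_val.comp (continuous_apply t.1)).matrix_elem t.2.1 t.2.2
  refine ((PiLp.continuous_toLp 2 _).comp hc).isClosedEmbedding ?_ |>.isEmbedding
  intro γ β h
  have h' : entries γ = entries β := WithLp.toLp_injective 2 h
  funext k
  exact Subtype.ext (Matrix.ext fun i j => congrFun h' (k, i, j))

/-- An `r`-tuple in `SO(d)^r` is generic if every polynomial with rational coefficients in `d²r`
variables that vanishes on its matrix entries vanishes everywhere on `SO(d)^r`. -/
def IsGeneric {r d : ℕ} (γ : Fin r → SO d) : Prop :=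
  ∀ p : MvPolynomial (Fin r × Fin d × Fin d) ℚ,
    MvPolynomial.aeval (entries γ) p = 0 →
      ∀ β : Fin r → SO d, MvPolynomial.aeval (entries β) p = 0

end SO

/-! There are countably many rational polynomials, so the non-generic tuples form a countable union
of closed sets `{p = 0}`, each with `p` not identically zero on the group. It suffices that each
such set is null: Haar measure charges nonempty open sets, so a closed null set is nowhere dense.

Nullity needs no manifold structure, only enough analytic curves through `1`. On a translated curve
`p` is analytic, so it vanishes identically or almost nowhere. By Fubini and invariance, almost
every zero of `p` stays a zero along the whole curve (`ae_forall_curve_mul_eq_zero`). If the points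
of such curves generate the group, almost every zero forces `p` to vanish on a dense set, hence
everywhere (`measure_zeroSet_eq_zero_of_curves_generate`). Generation of `SO(d)` comes from Cayley
transforms and plane rotations (`SO.closure_curvePoints`). -/

theorem AnalyticOnNhd.ae_ne_zero {f : ℝ → ℝ} (hf : AnalyticOnNhd ℝ f Set.univ) {t₀ : ℝ}
    (h : f t₀ ≠ 0) : ∀ᵐ t, f t ≠ 0 := by
  have h1 := hf.preimage_zero_mem_codiscrete h
  have h2 := ae_restrict_le_codiscreteWithin (μ := (volume : Measure ℝ)) MeasurableSet.univ h1
  rwa [Measure.restrict_univ] at h2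

/-! ### Null zero sets from invariance under analytic curves -/

section Translation

variable {G : Type*} [Group G] [TopologicalSpace G] [IsTopologicalGroup G]
  [SecondCountableTopology G] [MeasurableSpace G] [BorelSpace G]

theorem ae_forall_curve_mul_eq_zero (ν : Measure G) [IsFiniteMeasure ν] [ν.IsMulLeftInvariant]
    {q : G → ℝ} (hq : Continuous q) {c : ℝ → G} (hc : Continuous c) {t₀ : ℝ} (h1 : c t₀ = 1)
    (han : ∀ g, AnalyticOnNhd ℝ (fun t => q (c t * g)) Set.univ) :
    ∀ᵐ g ∂ν, q g = 0 → ∀ t, q (c t * g) = 0 := by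
  have hclosed : IsClosed {g | ∀ t, q (c t * g) = 0} := by
    simp only [Set.ofPred_forall]
    exact isClosed_iInter fun t =>
      isClosed_eq (hq.comp (continuous_const.mul continuous_id)) continuous_const
  have hsub : {g | ∀ t, q (c t * g) = 0} ⊆ {g | q g = 0} := fun g hg => by
    simpa [h1] using hg t₀
  -- Fubini: for fixed `g` the implication fails only at zeros of a nonzero analytic function of
  -- `t`.
  have key : ∀ᵐ t, ∀ᵐ g ∂ν, q (c t * g) = 0 → ∀ t, q (c t * g) = 0 := by
    rw [Measure.ae_ae_comm]
    · refine Filter.Eventually.of_forall fun g => ?_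
      by_cases hg : ∀ t, q (c t * g) = 0
      · exact Filter.Eventually.of_forall fun t _ => hg
      · obtain ⟨t, ht⟩ := not_forall.1 hg
        filter_upwards [(han g).ae_ne_zero ht] with u hu h
        exact absurd h hu
    · have hm1 : MeasurableSet {x : ℝ × G | q (c x.1 * x.2) = 0} :=
        (isClosed_eq (hq.comp ((hc.comp continuous_fst).mul continuous_snd))
          continuous_const).measurableSet
      have hm2 : MeasurableSet {x : ℝ × G | ∀ t, q (c t * x.2) = 0} :=
        (hclosed.preimage continuous_snd).measurableSet
      exact hm1.imp hm2
  obtain ⟨t, ht⟩ := key.exists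
  have hle : ν {g | q g = 0} ≤ ν {g | ∀ t, q (c t * g) = 0} := by
    rw [← measure_preimage_mul ν (c t) {g | q g = 0}]
    exact measure_mono_ae ht
  -- The zeros that persist along the curve form a subset of all zeros with no smaller, finite
  -- measure, so the two sets agree almost everywhere.
  have := ae_eq_of_subset_of_measure_ge hsub hle hclosed.measurableSet.nullMeasurableSet
    (measure_ne_top _ _)
  exact this.symm.le

theorem measure_zeroSet_eq_zero_of_curves_generate (ν : Measure G) [IsFiniteMeasure ν]
    [ν.IsMulLeftInvariant] {f : G → ℝ} (hf : Continuous f) {S : Set G}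
    (hS : Subgroup.closure S = ⊤)
    (hcurve : ∀ x ∈ S, ∃ c : ℝ → G, Continuous c ∧ (∃ t, c t = 1) ∧ (∃ t, c t = x) ∧
      ∀ h g, AnalyticOnNhd ℝ (fun t => f (h * c t * g)) Set.univ ∧
        AnalyticOnNhd ℝ (fun t => f (h * (c t)⁻¹ * g)) Set.univ)
    {b : G} (hb : f b ≠ 0) : ν {g | f g = 0} = 0 := by
  have step : ∀ h : G, ∀ᵐ g ∂ν, f g = 0 → f (h * g) = 0 := by
    intro h
    have hh : h ∈ Subgroup.closure S := hS ▸ Subgroup.mem_top h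
    induction hh using Subgroup.closure_induction_right with
    | one => simp
    | mul_right x _ y hy ih =>
      obtain ⟨c, hc, ⟨t₀, h1⟩, ⟨t, rfl⟩, han⟩ := hcurve y hy
      have := ae_forall_curve_mul_eq_zero ν (q := fun g => f (x * g))
        (hf.comp (continuous_const.mul continuous_id)) hc h1
        (fun g => by simpa only [mul_assoc] using (han x g).1)
      filter_upwards [ih, this] with g hg1 hg2 hg
      simpa only [mul_assoc] using hg2 (hg1 hg) t
    | mul_inv_cancel x _ y hy ih =>
      obtain ⟨c, hc, ⟨t₀, h1⟩, ⟨t, rfl⟩, han⟩ := hcurve y hy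
      have := ae_forall_curve_mul_eq_zero ν (q := fun g => f (x * g)) (c := fun t => (c t)⁻¹)
        (hf.comp (continuous_const.mul continuous_id)) hc.inv (t₀ := t₀) (by simp [h1])
        (fun g => by simpa only [mul_assoc] using (han x g).2)
      filter_upwards [ih, this] with g hg1 hg2 hg
      simpa only [mul_assoc] using hg2 (hg1 hg) t
  -- The null set in `step` depends on `h`; a countable dense family makes it uniform.
  have hall : ∀ᵐ g ∂ν, ∀ n, f g = 0 → f (TopologicalSpace.denseSeq G n * g) = 0 :=
    ae_all_iff.2 fun n => step _
  have : ∀ᵐ g ∂ν, f g ≠ 0 := by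
    filter_upwards [hall] with g hg h0
    have hfun : (fun h => f (h * g)) = fun _ => (0 : ℝ) :=
      Continuous.ext_on (TopologicalSpace.denseRange_denseSeq G)
        (hf.comp (continuous_id.mul continuous_const)) continuous_const
        (by rintro _ ⟨n, rfl⟩; exact hg n h0)
    exact hb (by simpa using congrFun hfun (b * g⁻¹))
  simpa [ae_iff] using this

end Translation

/-! ### Analytic curves of orthogonal matrices -/

namespace Matrix

variable {n : Type*}

theorem analyticAt_mul_apply [Fintype n] {M N : ℝ → Matrix n n ℝ} {t : ℝ}
    (hM : ∀ i j, AnalyticAt ℝ (fun t => M t i j) t)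
    (hN : ∀ i j, AnalyticAt ℝ (fun t => N t i j) t) (i j : n) :
    AnalyticAt ℝ (fun t => (M t * N t) i j) t := by
  simp only [mul_apply]
  exact Finset.analyticAt_fun_sum _ fun k _ => (hM i k).mul (hN k j)

section Invertible

variable [Fintype n] [DecidableEq n]

theorem analyticAt_det {M : ℝ → Matrix n n ℝ} {t : ℝ}
    (hM : ∀ i j, AnalyticAt ℝ (fun t => M t i j) t) : AnalyticAt ℝ (fun t => (M t).det) t := by
  simp only [det_apply']
  exact Finset.analyticAt_fun_sum _ fun σ _ =>
    analyticAt_const.mul (Finset.analyticAt_fun_prod _ fun i _ => hM _ _)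

theorem analyticAt_inv_apply {M : ℝ → Matrix n n ℝ} {t : ℝ}
    (hM : ∀ i j, AnalyticAt ℝ (fun t => M t i j) t) (hdet : (M t).det ≠ 0) (i j : n) :
    AnalyticAt ℝ (fun t => (M t)⁻¹ i j) t := by
  simp only [inv_def, smul_apply, smul_eq_mul, Ring.inverse_eq_inv', adjugate_apply]
  refine ((analyticAt_det hM).inv hdet).mul (analyticAt_det fun k l => ?_)
  simp only [updateRow_apply]
  split_ifs
  · exact analyticAt_const
  · exact hM k l

/-- Adding suitable signs to the diagonal keeps an invertible matrix invertible. -/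
theorem exists_sign_diagonal_add_det_ne_zero {M : Matrix n n ℝ} (hM : M.det ≠ 0) :
    ∃ s : n → ℝ, (∀ i, s i = 1 ∨ s i = -1) ∧ (diagonal s + M).det ≠ 0 := by
  suffices H : ∀ S : Finset n, ∃ s : n → ℝ, (∀ i ∈ S, s i = 1 ∨ s i = -1) ∧ (∀ i ∉ S, s i = 0) ∧
      (diagonal s + M).det ≠ 0 by
    obtain ⟨s, hs, -, h⟩ := H Finset.univ
    exact ⟨s, fun i => hs i (Finset.mem_univ i), h⟩
  intro S
  induction S using Finset.induction_on with
  | empty => exact ⟨0, by simp, by simp, by simpa using hM⟩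
  | insert a S ha ih =>
    obtain ⟨s, hs, hs0, h⟩ := ih
    have hupd : ∀ e : ℝ, diagonal (Function.update s a e) + M =
        (diagonal s + M).updateRow a ((diagonal s + M) a + e • Pi.single a 1) := by
      intro e
      ext i j
      by_cases hi : i = a
      · subst hi
        by_cases hj : i = j
        · subst hj
          simp [updateRow_apply, hs0 i ha]
          ring
        · simp [updateRow_apply, diagonal_apply_ne _ hj, Ne.symm hj]
      · by_cases hj : i = j
        · subst hj
          simp [updateRow_apply, hi]
        · simp [updateRow_apply, hi, diagonal_apply_ne _ hj]
    have hdet : ∀ e : ℝ, (diagonal (Function.update s a e) + M).det =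
        (diagonal s + M).det + e * ((diagonal s + M).updateRow a (Pi.single a 1)).det := by
      intro e
      rw [hupd, det_updateRow_add, det_updateRow_smul, updateRow_eq_self]
    -- The determinant is affine in `e`, so its value at `0`, which is nonzero, is the mean of its
    -- values at `1` and `-1`.
    have hex : ∃ e : ℝ, (e = 1 ∨ e = -1) ∧ (diagonal (Function.update s a e) + M).det ≠ 0 := by
      by_contra! hcon
      have h1 := hcon 1 (Or.inl rfl)
      have h2 := hcon (-1) (Or.inr rfl)
      rw [hdet] at h1 h2
      exact h (by linarith)
    obtain ⟨e, he, hne⟩ := hex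
    refine ⟨Function.update s a e, fun i hi => ?_, fun i hi => ?_, hne⟩
    · rcases eq_or_ne i a with rfl | hia
      · simpa using he
      · simpa [hia] using hs i ((Finset.mem_insert.1 hi).resolve_left hia)
    · rw [Finset.mem_insert, not_or] at hi
      simpa [hi.1] using hs0 i hi.2

section Cayley

variable {Q : Matrix n n ℝ}

theorem det_eq_one_of_det_one_add_ne_zero (hQ : Qᵀ * Q = 1) (h : (1 + Q).det ≠ 0) :
    Q.det = 1 := by
  have h1 : (1 + Q)ᵀ = Qᵀ * (1 + Q) := by
    rw [mul_add, hQ, transpose_add, transpose_one, mul_one, add_comm]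
  have h2 := congrArg det h1
  rw [det_transpose, det_mul, det_transpose] at h2
  exact mul_right_cancel₀ h (by rw [one_mul]; exact h2.symm)

/-- The cross terms cancel because `(1 + Q)ᵀ * (1 - Q) = Qᵀ - Q` is skew-symmetric. Evenness in `t`
gives orthogonality of the Cayley curve, positivity gives invertibility of its denominator. -/
theorem cayley_transpose_mul (hQ : Qᵀ * Q = 1) (t : ℝ) :
    ((1 + Q) + t • (1 - Q))ᵀ * ((1 + Q) + t • (1 - Q)) =
      (1 + Q)ᵀ * (1 + Q) + t ^ 2 • ((1 - Q)ᵀ * (1 - Q)) := by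
  simp only [transpose_add, transpose_sub, transpose_smul, transpose_one, mul_add, add_mul, mul_sub,
    sub_mul, smul_mul_assoc, mul_smul_comm, hQ, mul_one, one_mul]
  module

/-- Taking determinants, numerator and denominator of the Cayley curve have equal determinant once
`Q.det = 1`. -/
theorem cayley_transpose (hQ : Qᵀ * Q = 1) (t : ℝ) :
    ((1 + Q) + t • (1 - Q))ᵀ = Qᵀ * ((1 + Q) - t • (1 - Q)) := by
  simp only [transpose_add, transpose_sub, transpose_smul, transpose_one, mul_add, mul_sub,
    mul_smul_comm, hQ, mul_one]
  module

theorem cayley_det_ne_zero (hQ : Qᵀ * Q = 1) (h : (1 + Q).det ≠ 0) (t : ℝ) :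
    ((1 + Q) + t • (1 - Q)).det ≠ 0 := by
  intro h0
  obtain ⟨v, hv, hv0⟩ := exists_mulVec_eq_zero_iff.2 h0
  have h1 : v ⬝ᵥ ((((1 + Q) + t • (1 - Q))ᵀ * ((1 + Q) + t • (1 - Q))) *ᵥ v) = 0 := by
    rw [← mulVec_mulVec, hv0, mulVec_zero, dotProduct_zero]
  have hsq : ∀ A : Matrix n n ℝ, v ⬝ᵥ ((Aᵀ * A) *ᵥ v) = (A *ᵥ v) ⬝ᵥ (A *ᵥ v) := fun A => by
    rw [← mulVec_mulVec, dotProduct_mulVec, vecMul_transpose]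
  rw [cayley_transpose_mul hQ, add_mulVec, smul_mulVec, dotProduct_add, dotProduct_smul, hsq, hsq,
    smul_eq_mul] at h1
  have hN : 0 ≤ ((1 + Q) *ᵥ v) ⬝ᵥ ((1 + Q) *ᵥ v) :=
    Finset.sum_nonneg fun i _ => mul_self_nonneg _
  have hP : 0 ≤ ((1 - Q) *ᵥ v) ⬝ᵥ ((1 - Q) *ᵥ v) :=
    Finset.sum_nonneg fun i _ => mul_self_nonneg _
  have hz : ((1 + Q) *ᵥ v) ⬝ᵥ ((1 + Q) *ᵥ v) = 0 := by
    have := mul_nonneg (sq_nonneg t) hP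
    linarith
  exact h (exists_mulVec_eq_zero_iff.1 ⟨v, hv, dotProduct_self_eq_zero.1 hz⟩)

/-- For orthogonal `Q` without eigenvalue `-1`, the rescaled Cayley transform is a curve
in the special orthogonal group from `1` (at `t = 0`) to `Q` (at `t = 1`). -/
noncomputable def cayleyCurve (Q : Matrix n n ℝ) (t : ℝ) : Matrix n n ℝ :=
  ((1 + Q) - t • (1 - Q)) * ((1 + Q) + t • (1 - Q))⁻¹

theorem cayleyCurve_zero (h : (1 + Q).det ≠ 0) : cayleyCurve Q 0 = 1 := by
  simp only [cayleyCurve, zero_smul, sub_zero, add_zero]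
  exact mul_nonsing_inv _ (isUnit_iff_ne_zero.2 h)

theorem cayleyCurve_one (hQ : Qᵀ * Q = 1) (h : (1 + Q).det ≠ 0) : cayleyCurve Q 1 = Q := by
  have hu := isUnit_iff_ne_zero.2 (cayley_det_ne_zero hQ h 1)
  have e : (1 + Q) - (1 : ℝ) • (1 - Q) = Q * ((1 + Q) + (1 : ℝ) • (1 - Q)) := by
    simp only [mul_add, mul_smul_comm, mul_sub, mul_one]
    module
  rw [cayleyCurve, e, mul_assoc, mul_nonsing_inv _ hu, mul_one]

theorem cayleyCurve_orthogonal (hQ : Qᵀ * Q = 1) (h : (1 + Q).det ≠ 0) (t : ℝ) :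
    (cayleyCurve Q t)ᵀ * cayleyCurve Q t = 1 := by
  have hu := isUnit_iff_ne_zero.2 (cayley_det_ne_zero hQ h t)
  have e : ((1 + Q) - t • (1 - Q))ᵀ * ((1 + Q) - t • (1 - Q)) =
      ((1 + Q) + t • (1 - Q))ᵀ * ((1 + Q) + t • (1 - Q)) := by
    have := cayley_transpose_mul hQ (-t)
    rw [neg_smul, ← sub_eq_add_neg] at this
    rw [this, cayley_transpose_mul hQ t, neg_sq]
  set B := (1 + Q) + t • (1 - Q) with hB
  calc (cayleyCurve Q t)ᵀ * cayleyCurve Q t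
      = (B⁻¹)ᵀ * (((1 + Q) - t • (1 - Q))ᵀ * ((1 + Q) - t • (1 - Q))) * B⁻¹ := by
        rw [cayleyCurve, transpose_mul, ← hB]; simp only [mul_assoc]
    _ = (B * B⁻¹)ᵀ * (B * B⁻¹) := by rw [e, transpose_mul]; simp only [mul_assoc]
    _ = 1 := by rw [mul_nonsing_inv _ hu]; simp

theorem cayleyCurve_det (hQ : Qᵀ * Q = 1) (h : (1 + Q).det ≠ 0) (t : ℝ) :
    (cayleyCurve Q t).det = 1 := by
  have h2 := congrArg det (cayley_transpose hQ t)
  rw [det_transpose, det_mul, det_transpose, det_eq_one_of_det_one_add_ne_zero hQ h, one_mul] at h2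
  rw [cayleyCurve, det_mul, ← h2, ← det_mul,
    mul_nonsing_inv _ (isUnit_iff_ne_zero.2 (cayley_det_ne_zero hQ h t)), det_one]

theorem analyticAt_cayleyCurve (hQ : Qᵀ * Q = 1) (h : (1 + Q).det ≠ 0) (i j : n) (t : ℝ) :
    AnalyticAt ℝ (fun t => cayleyCurve Q t i j) t := by
  refine analyticAt_mul_apply (fun i j => ?_)
    (analyticAt_inv_apply (fun i j => ?_) (cayley_det_ne_zero hQ h t)) i j
  · exact analyticAt_const.sub (analyticAt_id.mul analyticAt_const)
  · exact analyticAt_const.add (analyticAt_id.mul analyticAt_const)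

end Cayley

end Invertible

section PlaneRotation

variable [DecidableEq n]

/-- The rotation by the angle `t` in the plane of the coordinates `i` and `j`. -/
noncomputable def planeRotation (i j : n) (t : ℝ) : Matrix n n ℝ :=
  1 + (Real.cos t - 1) • (single i i 1 + single j j 1) +
    Real.sin t • (single i j 1 - single j i 1)

variable {i j : n}

theorem planeRotation_zero : planeRotation i j 0 = 1 := by simp [planeRotation]

theorem planeRotation_pi (hij : i ≠ j) : planeRotation i j Real.pi =
    diagonal fun k => if k = i ∨ k = j then -1 else 1 := by
  rw [planeRotation, Real.cos_pi, Real.sin_pi, zero_smul, add_zero]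
  ext k l
  simp only [add_apply, smul_apply,
    single_apply, smul_eq_mul, one_apply, diagonal_apply]
  split_ifs <;> grind

theorem planeRotation_transpose (t : ℝ) : (planeRotation i j t)ᵀ = planeRotation i j (-t) := by
  simp only [planeRotation, transpose_add, transpose_one, transpose_smul, transpose_single,
    transpose_sub, Real.cos_neg, Real.sin_neg]
  module

theorem planeRotation_mul [Fintype n] (hij : i ≠ j) (t u : ℝ) :
    planeRotation i j t * planeRotation i j u = planeRotation i j (t + u) := by
  simp only [planeRotation, mul_add, add_mul, mul_sub, sub_mul, mul_one, one_mul, smul_mul_assoc,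
    mul_smul_comm, single_mul_single_same, single_mul_single_of_ne _ _ _ _ hij,
    single_mul_single_of_ne _ _ _ _ hij.symm, Real.cos_add, Real.sin_add]
  module

theorem planeRotation_orthogonal [Fintype n] (hij : i ≠ j) (t : ℝ) :
    (planeRotation i j t)ᵀ * planeRotation i j t = 1 := by
  rw [planeRotation_transpose, planeRotation_mul hij, neg_add_cancel, planeRotation_zero]

/-- A rotation is the square of the rotation by half the angle, and an orthogonal determinant
squares to `1`. -/
theorem planeRotation_det [Fintype n] (hij : i ≠ j) (t : ℝ) : (planeRotation i j t).det = 1 := by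
  have h := congrArg det (planeRotation_orthogonal hij (t / 2))
  rw [det_mul, det_transpose, det_one] at h
  rw [← add_halves t, ← planeRotation_mul hij, det_mul, h]

theorem analyticAt_planeRotation (k l : n) (t : ℝ) :
    AnalyticAt ℝ (fun t => planeRotation i j t k l) t := by
  simp only [planeRotation, add_apply, smul_apply, smul_eq_mul]
  fun_prop

end PlaneRotation

end Matrix

/-! ### Generation of `SO(d)` and the zero sets of polynomials -/

namespace SO

open Matrix

variable {d : ℕ}

/-- The rotations that lie on a curve in `SO(d)` through `1` with real analytic entries. -/
def curvePoints (d : ℕ) : Set (SO d) :=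
  {x | ∃ c : ℝ → SO d, (∀ i j t, AnalyticAt ℝ (fun t => (c t : Matrix (Fin d) (Fin d) ℝ) i j) t) ∧
    (∃ t, c t = 1) ∧ ∃ t, c t = x}

theorem mem_curvePoints_of_matrix {x : SO d} (M : ℝ → Matrix (Fin d) (Fin d) ℝ)
    (hM : ∀ t, (M t)ᵀ * M t = 1) (hdet : ∀ t, (M t).det = 1)
    (han : ∀ i j t, AnalyticAt ℝ (fun t => M t i j) t) {t₀ t₁ : ℝ} (h₀ : M t₀ = 1)
    (h₁ : M t₁ = x) : x ∈ curvePoints d :=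
  ⟨fun t => ⟨M t, (mem_iff _).2 ⟨hM t, hdet t⟩⟩, han, ⟨t₀, Subtype.ext h₀⟩, ⟨t₁, Subtype.ext h₁⟩⟩

theorem mem_curvePoints_of_det_one_add_ne_zero {x : SO d}
    (h : (1 + (x : Matrix (Fin d) (Fin d) ℝ)).det ≠ 0) : x ∈ curvePoints d := by
  have hx := ((mem_iff _).1 x.2).1
  exact mem_curvePoints_of_matrix (cayleyCurve x) (cayleyCurve_orthogonal hx h)
    (cayleyCurve_det hx h) (analyticAt_cayleyCurve hx h) (cayleyCurve_zero h)
    (cayleyCurve_one hx h)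

theorem exists_mem_closure_eq_planeRotation {i j : Fin d} (hij : i ≠ j) (t : ℝ) :
    ∃ x ∈ Subgroup.closure (curvePoints d),
      (x : Matrix (Fin d) (Fin d) ℝ) = planeRotation i j t := by
  refine ⟨⟨planeRotation i j t, (mem_iff _).2 ⟨planeRotation_orthogonal hij t,
    planeRotation_det hij t⟩⟩, Subgroup.subset_closure ?_, rfl⟩
  exact mem_curvePoints_of_matrix (planeRotation i j) (planeRotation_orthogonal hij)
    (planeRotation_det hij) analyticAt_planeRotation planeRotation_zero rfl

/-- Half turns in coordinate planes flip the signs two at a time. -/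
theorem exists_mem_closure_eq_diagonal (m : ℕ) (T : Finset (Fin d)) (hT : T.card = 2 * m) :
    ∃ x ∈ Subgroup.closure (curvePoints d),
      (x : Matrix (Fin d) (Fin d) ℝ) = diagonal fun k => if k ∈ T then -1 else 1 := by
  induction m generalizing T with
  | zero =>
    refine ⟨1, one_mem _, ?_⟩
    obtain rfl := Finset.card_eq_zero.1 hT
    simp
  | succ m ih =>
    obtain ⟨i, hi, j, hj, hij⟩ := Finset.one_lt_card.1 (show 1 < T.card by omega)
    have hj' : j ∈ T.erase i := Finset.mem_erase.2 ⟨hij.symm, hj⟩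
    obtain ⟨x, hx, hxd⟩ := ih ((T.erase i).erase j) (by
      rw [Finset.card_erase_of_mem hj', Finset.card_erase_of_mem hi]; omega)
    obtain ⟨y, hy, hyd⟩ := exists_mem_closure_eq_planeRotation hij Real.pi
    refine ⟨x * y, mul_mem hx hy, ?_⟩
    rw [Submonoid.coe_mul, hxd, hyd, planeRotation_pi hij, diagonal_mul_diagonal]
    congr 1
    funext k
    simp only [Finset.mem_erase]
    by_cases hki : k = i
    · simp [hki, hi]
    · by_cases hkj : k = j
      · simp [hkj, hj]
      · simp [hki, hkj]

/-- Choose a sign matrix `D` with `D + Q` invertible. Then `1 + D * Q = D * (D + Q)` is invertible,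
so `D * Q` lies on a Cayley curve and has determinant `1`. Hence `D.det = 1`, so `D` has evenly many
entries `-1` and is a product of half turns. -/
theorem closure_curvePoints (d : ℕ) : Subgroup.closure (curvePoints d) = ⊤ := by
  refine (Subgroup.eq_top_iff' _).2 fun x => ?_
  obtain ⟨hx, hxdet⟩ := (mem_iff _).1 x.2
  set Q := (x : Matrix (Fin d) (Fin d) ℝ)
  obtain ⟨s, hs, hsdet⟩ := exists_sign_diagonal_add_det_ne_zero (M := Q) (by rw [hxdet]; norm_num)
  have hss : diagonal s * diagonal s = 1 := by
    rw [diagonal_mul_diagonal, ← diagonal_one]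
    congr 1
    funext i
    rcases hs i with h | h <;> simp [h]
  have hsd : (diagonal s).det ≠ 0 := fun h => by
    have := congrArg det hss
    rw [det_mul, h, zero_mul, det_one] at this
    exact zero_ne_one this
  have horth : (diagonal s * Q)ᵀ * (diagonal s * Q) = 1 := by
    rw [transpose_mul, diagonal_transpose, mul_assoc, ← mul_assoc (diagonal s), hss, one_mul, hx]
  have hne : (1 + diagonal s * Q).det ≠ 0 := by
    rw [← hss, ← mul_add, det_mul]
    exact mul_ne_zero hsd hsdet
  have hdet := det_eq_one_of_det_one_add_ne_zero horth hne
  have hprod : ∏ i, s i = 1 := by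
    rwa [det_mul, hxdet, mul_one, det_diagonal] at hdet
  set T := Finset.univ.filter fun i => s i = -1 with hTdef
  have hsT : s = fun k => if k ∈ T then -1 else 1 := by
    funext k
    rcases hs k with h | h
    · simp only [hTdef, Finset.mem_filter, h]; norm_num
    · simp [hTdef, h]
  have heven : Even T.card := by
    have h : ∏ k, (if k ∈ T then (-1 : ℝ) else 1) = 1 := by rw [← hsT]; exact hprod
    rw [Finset.prod_ite_mem, Finset.univ_inter, Finset.prod_const] at h
    exact (neg_one_pow_eq_one_iff_even (by norm_num)).1 h
  obtain ⟨m, hm⟩ := heven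
  obtain ⟨y, hy, hyd⟩ := exists_mem_closure_eq_diagonal m T (by omega)
  rw [← hsT] at hyd
  have hz : y * x ∈ curvePoints d :=
    mem_curvePoints_of_det_one_add_ne_zero (by rw [Submonoid.coe_mul, hyd]; exact hne)
  have := mul_mem (inv_mem hy) (Subgroup.subset_closure hz)
  rwa [inv_mul_cancel_left] at this

section Tuples

variable {r : ℕ}

theorem continuous_of_analyticAt_entries {c : ℝ → SO d}
    (hc : ∀ i j t, AnalyticAt ℝ (fun t => (c t : Matrix (Fin d) (Fin d) ℝ) i j) t) :
    Continuous c := by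
  refine continuous_induced_rng.2 (continuous_matrix fun i j => ?_)
  exact continuous_iff_continuousAt.2 fun t => (hc i j t).continuousAt

theorem continuous_aeval_entries (p : MvPolynomial (Fin r × Fin d × Fin d) ℚ) :
    Continuous fun γ : Fin r → SO d => MvPolynomial.aeval (entries γ) p := by
  have he : Continuous (entries : (Fin r → SO d) → _) :=
    ((PiLp.continuous_ofLp 2 _).comp (isEmbedding_entries r d).continuous)
  simp only [MvPolynomial.aeval_def, MvPolynomial.eval₂_eq]
  fun_prop

theorem closure_mulSingle_curvePoints (r d : ℕ) :
    Subgroup.closure {x : Fin r → SO d | ∃ k, ∃ y ∈ curvePoints d, x = Pi.mulSingle k y} = ⊤ := by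
  refine (Subgroup.eq_top_iff' _).2 fun x => Subgroup.pi_mem_of_mulSingle_mem x fun k => ?_
  have hle : Subgroup.closure (curvePoints d) ≤ (Subgroup.closure
      {x : Fin r → SO d | ∃ k, ∃ y ∈ curvePoints d, x = Pi.mulSingle k y}).comap
      (MonoidHom.mulSingle (fun _ => SO d) k) :=
    (Subgroup.closure_le _).2 fun y hy => Subgroup.subset_closure ⟨k, y, hy, rfl⟩
  exact hle (closure_curvePoints d ▸ Subgroup.mem_top (x k))

theorem analyticOnNhd_aeval_entries (p : MvPolynomial (Fin r × Fin d × Fin d) ℚ)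
    {c : ℝ → Fin r → SO d}
    (hc : ∀ k i j t, AnalyticAt ℝ (fun t => (c t k : Matrix (Fin d) (Fin d) ℝ) i j) t)
    (h g : Fin r → SO d) :
    AnalyticOnNhd ℝ (fun t => MvPolynomial.aeval (entries (h * c t * g)) p) Set.univ := by
  refine fun t _ => AnalyticAt.aeval_mvPolynomial (fun s => ?_) p
  simp only [entries, Pi.mul_apply, Submonoid.coe_mul]
  refine analyticAt_mul_apply (M := fun t => (h s.1 * c t s.1 : Matrix (Fin d) (Fin d) ℝ))
    (N := fun _ => g s.1) (fun i j => ?_) (fun _ _ => analyticAt_const) _ _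
  exact analyticAt_mul_apply (M := fun _ => (h s.1 : Matrix (Fin d) (Fin d) ℝ))
    (fun _ _ => analyticAt_const) (fun i j => hc s.1 i j t) i j

theorem measure_zeroSet_eq_zero (ν : Measure (Fin r → SO d)) [ν.IsHaarMeasure]
    (p : MvPolynomial (Fin r × Fin d × Fin d) ℚ) {β : Fin r → SO d}
    (hβ : MvPolynomial.aeval (entries β) p ≠ 0) :
    ν {γ | MvPolynomial.aeval (entries γ) p = 0} = 0 := by
  refine measure_zeroSet_eq_zero_of_curves_generate ν (continuous_aeval_entries p)
    (closure_mulSingle_curvePoints r d) ?_ hβ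
  rintro _ ⟨k, y, ⟨c, hc, ⟨t₀, h₀⟩, ⟨t₁, h₁⟩⟩, rfl⟩
  have han : ∀ l i j t, AnalyticAt ℝ
      (fun t => (Pi.mulSingle (M := fun _ : Fin r => SO d) k (c t) l :
        Matrix (Fin d) (Fin d) ℝ) i j) t := by
    intro l i j t
    by_cases hl : l = k
    · subst hl
      simpa using hc i j t
    · simpa [hl] using analyticAt_const
  refine ⟨fun t => Pi.mulSingle k (c t),
    (continuous_mulSingle k).comp (continuous_of_analyticAt_entries hc),
    ⟨t₀, by simp [h₀]⟩, ⟨t₁, by simp [h₁]⟩, fun h g => ⟨?_, ?_⟩⟩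
  · exact analyticOnNhd_aeval_entries p han h g
  -- Inversion in `SO(d)` is transposition, so the inverse curve has the same entries with indices
  -- swapped.
  · exact analyticOnNhd_aeval_entries p (c := fun t => (Pi.mulSingle k (c t))⁻¹)
      (fun l i j t => han l j i t) h g

theorem setOf_not_isGeneric :
    {γ : Fin r → SO d | ¬ IsGeneric γ} =
      ⋃ p ∈ {p : MvPolynomial (Fin r × Fin d × Fin d) ℚ |
        ∃ β : Fin r → SO d, MvPolynomial.aeval (entries β) p ≠ 0},
        {γ | MvPolynomial.aeval (entries γ) p = 0} := by
  ext γ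
  simp only [IsGeneric, Set.mem_ofPred_eq, Set.mem_iUnion, not_forall, exists_prop]
  exact exists_congr fun p => and_comm

theorem countable_mvPolynomial_rat {σ : Type*} [Countable σ] : Countable (MvPolynomial σ ℚ) := by
  rw [← Cardinal.mk_le_aleph0_iff]
  refine MvPolynomial.cardinalMk_le_max_lift.trans ?_
  simp

end Tuples

end SO

theorem lemma1p3 (r d : ℕ) (hr : 1 ≤ r) (hd : 2 ≤ d) :
    (∀ ν : Measure (Fin r → SO d), ν.IsHaarMeasure →
        ν {γ : Fin r → SO d | ¬ SO.IsGeneric γ} = 0) ∧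
      IsMeagre {γ : Fin r → SO d | ¬ SO.IsGeneric γ} := by
  have := SO.countable_mvPolynomial_rat (σ := Fin r × Fin d × Fin d)
  rw [SO.setOf_not_isGeneric]
  refine ⟨fun ν hν => (measure_biUnion_null_iff (Set.to_countable _)).2 fun p ⟨β, hβ⟩ =>
    SO.measure_zeroSet_eq_zero ν p hβ, ?_⟩
  obtain ⟨ν, hν, -⟩ := SO.exists_isHaarMeasure r d
  refine isMeagre_biUnion (Set.to_countable _) fun p ⟨β, hβ⟩ => ?_
  exact (IsNowhereDense.of_isClosed_null (isClosed_eq (SO.continuous_aeval_entries p)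
    continuous_const) (SO.measure_zeroSet_eq_zero ν p hβ)).isMeagre
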